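/- **The game.** Let $\Theta=[K]$ be the finite set of follower types, $[M]$ and $[N]$ the action sets of the leader and the follower, $L:[M]\times[N]\to\mathbb{R}$ the leader's utility with $|L|\le B$, and $F^\theta:[M]\times[N]\to\mathbb{R}$ the utility of the type-$\theta$ follower. A signaling commitment $\sigma=(\mathbf{x},\mathbf{C})$ consists of a mixed strategy $\mathbf{x}\in\Delta_M$ and numbers $C^\theta_{ij}\ge 0$ with $\sum_{j}C^\theta_{ij}=\mathbf{x}_i$ for all $i,\theta$; here $C^{\theta}_{ij}$ is the probability that the leader plays $i$ and sends signal $j\in[N]$ when the reported type is $\theta$. A follower of type $\theta$ first makes a report $\hat\theta$ that maximizes $$U(\sigma,(\hat\theta;\theta))=\sum_{j}\max_{j'}\sum_i C^{\hat\theta}_{ij}F^\theta_{ij'},$$ and then answers signal $j$ by an action $j'$ that maximizes $\sum_i C^{\hat\theta}_{ij}F^\theta_{ij'}$; he reports truthfully if that is optimal, follows the recommendation $j'=j$ if that is optimal, and breaks other ties by an arbitrary fixed rule. For $\mu\in\Delta(\Theta)$ let $\mathrm{OPT}(\mu)$ (the equilibrium payoff) be the supremum over all signaling commitments $\sigma$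 of the leader's expected payoff when the type is drawn from $\mu$ and the follower behaves in this way. **The algorithm.** Call $\sigma$ feasible if for all $\theta$ $$\sum_i C^\theta_{ij}F^\theta_{ij}\ge\sum_i C^\theta_{ij}F^\theta_{ij'}\ \ (j\ne j'),\qquad \sum_{i,j}C^\theta_{ij}F^\theta_{ij}\ge\sum_j\max_{j'}\sum_iC^{\hat\theta}_{ij}F^\theta_{ij'}\ \ (\hat\theta\neq\theta).$$ In rounds $t=1,\dots,T$ the types $\theta_t$ are drawn i.i.d. from an unknown $\mu^*\in\Delta(\Theta)$. Follow-the-incentive-compatible-leader commits in round $t+1$ to some $$\sigma_{t+1}\in\arg\max_{\sigma\text{ feasible}}\ \sum_{\tau\le t}V(\sigma,\theta_\tau),\qquad V(\sigma,\theta)=\sum_{i,j}C^\theta_{ij}L_{ij},$$ i.e. it solves the signaling linear program with the empirical type distribution in place of the prior (ties, including the choice of $\sigma_1$, may be broken by any rule based on the past). In each round the follower reports, the leader's action $i_t$ and the signal are drawn from the commitment given the report, and the follower responds with $j_t$. Let $$\mathrm{Gap}(\mu^*,T)=\mathrm{OPT}(\mu^*)\,T-\sum_{t=1}^T L(i_t,j_t).$$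 **Theorem.** For every $K$ and $B$ there is a constant $c=c(K,B)$ such that for all $M,N$, all such games with $K$ types and $|L|\le B$, all follower tie-breaking rules and all tie-breaking rules of the algorithm, all $\mu^*\in\Delta(\Theta)$ and all $T\ge1$, with probability at least $1-T^{1-3\sqrt M/56}-T^{-8M}$, $$\mathrm{Gap}(\mu^*,T)\le c\,\sqrt{MT}\,\bigl(1+2\sqrt{\log T}\bigr).$$ -/

import Mathlib

namespace SigBSG

/-- A Bayesian Stackelberg game: leader actions `Fin M`, follower actions `Fin N`, follower types
`Fin K`; `L i j` is the leader's payoff, `F θ i j` the payoff of the follower of type `θ`. -/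
structure Game (M N K : ℕ) where
  L : Fin M → Fin N → ℝ
  F : Fin K → Fin M → Fin N → ℝ

/-- A signaling commitment `σ = (x, C)` with direct signals `Fin N`: `C θ i j` is the probability
that the leader plays `i` and sends signal `j` when the reported type is `θ`. -/
structure Commitment (M N K : ℕ) where
  x : Fin M → ℝ
  C : Fin K → Fin M → Fin N → ℝ
  mem_simplex : x ∈ stdSimplex ℝ (Fin M)
  sum_C : ∀ θ i, ∑ j, C θ i j = x i
  nonneg : ∀ θ i j, 0 ≤ C θ i j

variable {M N K : ℕ}

namespace Commitment

theorem sum_joint (σ : Commitment M N K) (θ : Fin K) :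
    ∑ p : Fin M × Fin N, ENNReal.ofReal (σ.C θ p.1 p.2) = 1 := by
  rw [← ENNReal.ofReal_sum_of_nonneg (fun p _ => σ.nonneg θ p.1 p.2), Fintype.sum_prod_type]
  simp only [σ.sum_C, σ.mem_simplex.2, ENNReal.ofReal_one]

/-- The joint law of (leader's realized action, signal) when the reported type is `θ`. -/
noncomputable def joint (σ : Commitment M N K) (θ : Fin K) : PMF (Fin M × Fin N) :=
  PMF.ofFintype (fun p => ENNReal.ofReal (σ.C θ p.1 p.2)) (σ.sum_joint θ)

end Commitment

namespace Game

/-- `j'` is a best response of the type-`θ` follower who reported `r` and received signal `j`.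
The unnormalized weights `σ.C r i j` have the same maximizers as the posterior
`σ.C r i j / ∑ i, σ.C r i j` on the leader's realized action. -/
def IsBestResponse (G : Game M N K) (σ : Commitment M N K) (r θ : Fin K) (j j' : Fin N) : Prop :=
  ∀ k, ∑ i, σ.C r i j * G.F θ i k ≤ ∑ i, σ.C r i j * G.F θ i j'

/-- Expected utility `U(σ, (r; θ))` of the type-`θ` follower who reports `r` and then best
responds to each signal. -/
noncomputable def U (G : Game M N K) (σ : Commitment M N K) (r θ : Fin K) : ℝ :=
  ∑ j, ⨆ j', ∑ i, σ.C r i j * G.F θ i j'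

/-- `r` is an optimal report for the type-`θ` follower. -/
def IsOptimalReport (G : Game M N K) (σ : Commitment M N K) (θ r : Fin K) : Prop :=
  ∀ r', G.U σ r' θ ≤ G.U σ r θ

/-- A rational follower: an optimal reporting rule and a best-response rule. Ties are resolved in
favor of truth-telling and of the recommended action; other ties are resolved arbitrarily. -/
structure Follower (G : Game M N K) where
  report : Commitment M N K → Fin K → Fin K
  response : Commitment M N K → Fin K → Fin K → Fin N → Fin N
  report_optimal : ∀ σ θ, G.IsOptimalReport σ θ (report σ θ)
  report_truthful : ∀ σ θ, G.IsOptimalReport σ θ θ → report σ θ = θ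
  response_optimal : ∀ σ r θ j, G.IsBestResponse σ r θ j (response σ r θ j)
  response_obedient : ∀ σ r θ j, G.IsBestResponse σ r θ j j → response σ r θ j = j

/-- The leader's expected payoff under `σ` when the prior over types is `μ` and the follower
reports and responds according to `f`. -/
noncomputable def leaderValue (G : Game M N K) (f : G.Follower) (μ : PMF (Fin K))
    (σ : Commitment M N K) : ℝ :=
  ∑ θ, (μ θ).toReal *
    ∑ i, ∑ j, σ.C (f.report σ θ) i j * G.L i (f.response σ (f.report σ θ) θ j)

/-- The signaling Bayesian Stackelberg equilibrium payoff `OPT(μ)`: the supremum of the leader's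
expected payoff over all signaling commitments, incentive compatible or not. -/
noncomputable def opt (G : Game M N K) (f : G.Follower) (μ : PMF (Fin K)) : ℝ :=
  ⨆ σ : Commitment M N K, G.leaderValue f μ σ

/-- The obedience and incentive-compatibility constraints of the signaling linear program (its
remaining constraints are part of `Commitment`). -/
structure IsIC (G : Game M N K) (σ : Commitment M N K) : Prop where
  obedient : ∀ θ j j', j ≠ j' →
    ∑ i, σ.C θ i j * G.F θ i j' ≤ ∑ i, σ.C θ i j * G.F θ i j
  truthful : ∀ θ r, r ≠ θ →
    ∑ j, (⨆ j', ∑ i, σ.C r i j * G.F θ i j') ≤ ∑ i, ∑ j, σ.C θ i j * G.F θ i j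

/-- `V(σ, θ)`: the leader's expected payoff against type `θ` if the follower reports truthfully
and follows the recommendation. -/
def V (G : Game M N K) (σ : Commitment M N K) (θ : Fin K) : ℝ :=
  ∑ i, ∑ j, σ.C θ i j * G.L i j

end Game

/-- What happens in one round: follower's true type, reported type, leader's realized action,
signal, follower's action. -/
structure Round (M N K : ℕ) where
  type : Fin K
  report : Fin K
  action : Fin M
  signal : Fin N
  response : Fin N

/-- A learning policy of the leader: the next commitment as a function of the past rounds
(most recent first). -/
abbrev Policy (M N K : ℕ) := List (Round M N K) → Commitment M N K

namespace Game

/-- Follow-the-incentive-compatible-leader: after every history, the policy commits to some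
maximizer, among the commitments feasible for the signaling linear program, of the cumulative
past payoff. -/
def IsFTLIC (G : Game M N K) (π : Policy M N K) : Prop :=
  ∀ h, G.IsIC (π h) ∧ ∀ σ, G.IsIC σ →
    (h.map fun r => G.V σ r.type).sum ≤ (h.map fun r => G.V (π h) r.type).sum

/-- The law of one round under commitment `σ`: nature draws the type, the follower reports, the
leader's action and the signal are drawn, the follower responds. -/
noncomputable def roundLaw (G : Game M N K) (f : G.Follower) (μ : PMF (Fin K))
    (σ : Commitment M N K) : PMF (Round M N K) :=
  μ.bind fun θ => (σ.joint (f.report σ θ)).map fun p =>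
    ⟨θ, f.report σ θ, p.1, p.2, f.response σ (f.report σ θ) θ p.2⟩

/-- The law of the history of the first `T` rounds, with types drawn independently from `μ`. -/
noncomputable def historyLaw (G : Game M N K) (f : G.Follower) (μ : PMF (Fin K))
    (π : Policy M N K) : ℕ → PMF (List (Round M N K))
  | 0 => PMF.pure []
  | t + 1 => (historyLaw G f μ π t).bind fun h => (G.roundLaw f μ (π h)).map fun r => r :: h

/-- The performance gap `OPT(μ) T - ∑ t, L(i_t, j_t)` on the realized history `h` of length `T`. -/
noncomputable def gap (G : Game M N K) (f : G.Follower) (μ : PMF (Fin K)) (T : ℕ)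
    (h : List (Round M N K)) : ℝ :=
  G.opt f μ * T - (h.map fun r => G.L r.action r.response).sum

end Game

end SigBSG

/-! A feasible commitment makes the follower truthful and obedient, and by the revelation principle
(`direct_isIC`, `leaderValue_eq_meanV_direct`) every commitment can be replaced by a feasible one
with the same leader payoff. So `opt` is controlled by the values of `meanV` on feasible commitments
(`opt_le`), and along the play the gap is the sum of `opt - meanV (π h)` plus the sum of `meanV (π
h)` minus the realized payoff.

The second sum is a martingale with increments at most `2B`, bounded by Azuma–Hoeffding. For the
first, `V σ` is a vector of only `K` numbers bounded by `B`, so the empirical and true values of all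
commitments differ uniformly by at most `B` times the ℓ¹ deviation of the type frequencies
(`length_mul_opt_sub_meanV_le`). No covering of the commitments is needed, and `N` disappears. If
all deviations after `t` rounds are at most `√(A t)`, the losses add up to order `√(A T)`
(`gap_cons_le`). The number of actions enters only through the confidence levels, chosen
proportional to `M log T`. -/

open scoped ENNReal

namespace SigBSG

/-! ### Expectations under probability mass functions and Markov's inequality. -/

section Expectation

variable {α β : Type*}

/-- Expectation of a nonnegative extended function under a probability mass function. -/
noncomputable def expect (p : PMF α) (g : α → ℝ≥0∞) : ℝ≥0∞ := ∑' a, p a * g a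

theorem expect_pure (a : α) (g : α → ℝ≥0∞) : expect (PMF.pure a) g = g a := by
  unfold expect
  rw [tsum_eq_single a]
  · simp
  · intro b hb
    simp [hb]

theorem expect_bind (p : PMF α) (q : α → PMF β) (g : β → ℝ≥0∞) :
    expect (p.bind q) g = expect p fun a => expect (q a) g := by
  simp only [expect, PMF.bind_apply, ← ENNReal.tsum_mul_right, ← ENNReal.tsum_mul_left]
  rw [ENNReal.tsum_comm]
  simp only [mul_assoc]

theorem expect_map (p : PMF α) (q : α → β) (g : β → ℝ≥0∞) :
    expect (p.map q) g = expect p fun a => g (q a) := by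
  rw [← PMF.bind_pure_comp, expect_bind]
  simp only [Function.comp_apply, expect_pure]

theorem expect_add (p : PMF α) (g g' : α → ℝ≥0∞) :
    expect p (fun a => g a + g' a) = expect p g + expect p g' := by
  simp only [expect, mul_add, ENNReal.tsum_add]

theorem expect_sum {ι : Type*} (s : Finset ι) (p : PMF α) (g : ι → α → ℝ≥0∞) :
    expect p (fun a => ∑ i ∈ s, g i a) = ∑ i ∈ s, expect p (g i) := by
  simp only [expect, Finset.mul_sum]
  exact Summable.tsum_finsetSum fun _ _ => ENNReal.summable

theorem expect_const_mul (p : PMF α) (c : ℝ≥0∞) (g : α → ℝ≥0∞) :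
    expect p (fun a => c * g a) = c * expect p g := by
  simp only [expect, mul_left_comm _ c, ENNReal.tsum_mul_left]

theorem expect_const (p : PMF α) (c : ℝ≥0∞) : expect p (fun _ => c) = c := by
  simp only [expect, ENNReal.tsum_mul_right, p.tsum_coe, one_mul]

theorem expect_mono (p : PMF α) {g g' : α → ℝ≥0∞} (h : ∀ a, g a ≤ g' a) :
    expect p g ≤ expect p g' :=
  ENNReal.tsum_le_tsum fun a => mul_le_mul_right (h a) _

/-- Markov's inequality: a set that contains every outcome at which `g` is below one has
probability at least `1 - ε` if `g` has expectation at most `ε`. -/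
theorem one_sub_le_toOuterMeasure (p : PMF α) (s : Set α) (g : α → ℝ≥0∞) (ε : ℝ) (hε : 0 ≤ ε)
    (hs : ∀ a ∈ p.support, a ∉ s → 1 ≤ g a) (hg : expect p g ≤ ENNReal.ofReal ε) :
    1 - ε ≤ (p.toOuterMeasure s).toReal := by
  have h1 : (1 : ℝ≥0∞) ≤ p.toOuterMeasure s + expect p g := by
    rw [← p.tsum_coe, PMF.toOuterMeasure_apply, expect, ← ENNReal.tsum_add]
    refine ENNReal.tsum_le_tsum fun a => ?_
    by_cases ha : a ∈ s
    · simp [ha]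
    · by_cases hp : a ∈ p.support
      · calc p a = p a * 1 := (mul_one _).symm
          _ ≤ p a * g a := mul_le_mul_right (hs a hp ha) _
          _ ≤ _ := le_add_self
      · rw [PMF.mem_support_iff, not_not] at hp
        simp [hp]
  have h2 : p.toOuterMeasure s ≤ 1 := by
    rw [PMF.toOuterMeasure_apply, ← p.tsum_coe]
    exact ENNReal.tsum_le_tsum fun a => Set.indicator_le_self _ _ _
  have h3 : p.toOuterMeasure s ≠ ∞ := ne_top_of_le_ne_top ENNReal.one_ne_top h2
  have h4 := ENNReal.toReal_mono (ENNReal.add_ne_top.2 ⟨h3, ENNReal.ofReal_ne_top⟩)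
    (h1.trans (add_le_add_right hg _))
  rw [ENNReal.toReal_add h3 ENNReal.ofReal_ne_top, ENNReal.toReal_ofReal hε,
    ENNReal.toReal_one] at h4
  linarith

end Expectation

/-! ### Hoeffding's lemma. -/

/-- Chord bound for the exponential on `[-b, b]`. -/
theorem exp_le_cosh_add {x b : ℝ} (hb : 0 < b) (hx : |x| ≤ b) :
    Real.exp x ≤ Real.cosh b + x / b * Real.sinh b := by
  obtain ⟨h1, h2⟩ := abs_le.1 hx
  have h := @convexOn_exp.2 b (Set.mem_univ b) (-b) (Set.mem_univ (-b))
    ((1 + x / b) / 2) ((1 - x / b) / 2)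
    (by have : -1 ≤ x / b := by rw [le_div_iff₀ hb]; linarith
        linarith)
    (by have : x / b ≤ 1 := by rw [div_le_iff₀ hb]; linarith
        linarith) (by ring)
  have e : ((1 + x / b) / 2) • b + ((1 - x / b) / 2) • (-b) = x := by
    simp only [smul_eq_mul]
    field_simp
    ring
  rw [e] at h
  rw [Real.cosh_eq, Real.sinh_eq]
  simp only [smul_eq_mul] at h
  linarith

/-- Hoeffding's lemma for a finitely supported centred random variable. -/
theorem sum_mul_exp_le {ι : Type*} [Fintype ι] (w X : ι → ℝ) {b : ℝ} (hb : 0 < b)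
    (hw : ∀ i, 0 ≤ w i) (hw1 : ∑ i, w i = 1) (hX : ∀ i, |X i| ≤ b) (h0 : ∑ i, w i * X i = 0) :
    ∑ i, w i * Real.exp (X i) ≤ Real.exp (b ^ 2 / 2) := by
  calc ∑ i, w i * Real.exp (X i)
      ≤ ∑ i, w i * (Real.cosh b + X i / b * Real.sinh b) :=
        Finset.sum_le_sum fun i _ => mul_le_mul_of_nonneg_left (exp_le_cosh_add hb (hX i)) (hw i)
    _ = (∑ i, w i) * Real.cosh b + (∑ i, w i * X i) * (Real.sinh b / b) := by
        rw [Finset.sum_mul, Finset.sum_mul, ← Finset.sum_add_distrib]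
        exact Finset.sum_congr rfl fun i _ => by ring
    _ = Real.cosh b := by rw [hw1, h0]; ring
    _ ≤ _ := Real.cosh_le_exp_half_sq b

theorem sum_toReal_eq_one {α : Type*} [Fintype α] (p : PMF α) : ∑ a, (p a).toReal = 1 := by
  rw [← ENNReal.toReal_sum fun a _ => p.apply_ne_top a, ← tsum_fintype (L := .unconditional α), p.tsum_coe,
    ENNReal.toReal_one]

theorem Commitment.sum_C_eq_one {M N K : ℕ} (σ : Commitment M N K) (θ : Fin K) :
    ∑ i, ∑ j, σ.C θ i j = 1 := by
  simp only [σ.sum_C, σ.mem_simplex.2]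

/-! ### Revelation principle and the law of one round. -/

namespace Game

variable {M N K : ℕ} (G : Game M N K)

theorem sum_le_U (σ : Commitment M N K) (r θ : Fin K) (ρ : Fin N → Fin N) :
    ∑ j, ∑ i, σ.C r i j * G.F θ i (ρ j) ≤ G.U σ r θ :=
  Finset.sum_le_sum fun j _ =>
    le_ciSup (f := fun j' => ∑ i, σ.C r i j * G.F θ i j') (Set.finite_range _).bddAbove (ρ j)

theorem U_eq_sum_response (f : G.Follower) (σ : Commitment M N K) (r θ : Fin K) :
    G.U σ r θ = ∑ j, ∑ i, σ.C r i j * G.F θ i (f.response σ r θ j) := by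
  refine le_antisymm (Finset.sum_le_sum fun j _ => ?_) (G.sum_le_U σ r θ _)
  have : Nonempty (Fin N) := ⟨j⟩
  exact ciSup_le fun k => f.response_optimal σ r θ j k

variable {G}

/-- The incentive constraint bounds the value of a misreport by the value of truth followed by
obedience, which is at most `U σ θ θ`. Truth is thus optimal, and ties favor it. -/
theorem IsIC.report_eq {σ : Commitment M N K} (hσ : G.IsIC σ) (f : G.Follower) (θ : Fin K) :
    f.report σ θ = θ := by
  refine f.report_truthful σ θ fun r => ?_
  by_cases hr : r = θ
  · rw [hr]
  · refine (hσ.truthful θ r hr).trans ?_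
    rw [Finset.sum_comm]
    exact G.sum_le_U σ θ θ id

theorem IsIC.response_eq {σ : Commitment M N K} (hσ : G.IsIC σ) (f : G.Follower) (θ : Fin K)
    (j : Fin N) : f.response σ θ θ j = j := by
  refine f.response_obedient σ θ θ j fun k => ?_
  by_cases hk : j = k
  · rw [hk]
  · exact hσ.obedient θ j k hk

variable (G)

/-- The direct commitment that recommends to each type what the follower would do under `σ`. -/
noncomputable def direct (f : G.Follower) (σ : Commitment M N K) : Commitment M N K where
  x := σ.x
  C θ i j := ∑ k, if f.response σ (f.report σ θ) θ k = j then σ.C (f.report σ θ) i k else 0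
  mem_simplex := σ.mem_simplex
  sum_C θ i := by
    rw [Finset.sum_comm]
    simp [σ.sum_C]
  nonneg θ i j := Finset.sum_nonneg fun k _ => by
    split_ifs
    · exact σ.nonneg _ _ _
    · exact le_rfl

theorem sum_direct_C_mul (f : G.Follower) (σ : Commitment M N K) (θ : Fin K) (j : Fin N)
    (g : Fin M → ℝ) :
    ∑ i, (G.direct f σ).C θ i j * g i = ∑ k, if f.response σ (f.report σ θ) θ k = j then
      ∑ i, σ.C (f.report σ θ) i k * g i else 0 := by
  simp only [direct, Finset.sum_mul]
  rw [Finset.sum_comm]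
  refine Finset.sum_congr rfl fun k _ => ?_
  split_ifs <;> simp

theorem sum_sum_direct_C_mul (f : G.Follower) (σ : Commitment M N K) (θ : Fin K)
    (g : Fin M → Fin N → ℝ) :
    ∑ i, ∑ j, (G.direct f σ).C θ i j * g i j =
      ∑ i, ∑ j, σ.C (f.report σ θ) i j * g i (f.response σ (f.report σ θ) θ j) := by
  rw [Finset.sum_comm]
  simp only [sum_direct_C_mul]
  rw [Finset.sum_comm, Finset.sum_comm (s := (Finset.univ : Finset (Fin M)))]
  simp

/-- The revelation principle, feasibility part. -/
theorem direct_isIC (f : G.Follower) (σ : Commitment M N K) : G.IsIC (G.direct f σ) where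
  obedient θ j j' _ := by
    rw [sum_direct_C_mul, sum_direct_C_mul]
    -- Every signal `k` merged into `j` had `j` as a best response, and adding up keeps it best.
    refine Finset.sum_le_sum fun k _ => ?_
    split_ifs with h
    · rw [← h]
      exact f.response_optimal σ _ θ k j'
    · exact le_rfl
  truthful θ r _ := by
    rw [sum_sum_direct_C_mul, Finset.sum_comm, ← U_eq_sum_response]
    -- Mimicking `r` under `direct` is no better than reporting `f.report σ r` under `σ`, because
    -- merging signals only loses information.
    refine le_trans ?_ (f.report_optimal σ θ (f.report σ r))
    calc _ ≤ ∑ j, ∑ k, if f.response σ (f.report σ r) r k = j then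
          (⨆ j', ∑ i, σ.C (f.report σ r) i k * G.F θ i j') else 0 := by
          refine Finset.sum_le_sum fun j _ => ?_
          have : Nonempty (Fin N) := ⟨j⟩
          refine ciSup_le fun j' => ?_
          rw [sum_direct_C_mul]
          refine Finset.sum_le_sum fun k _ => ?_
          split_ifs
          · exact le_ciSup (f := fun j' => ∑ i, σ.C (f.report σ r) i k * G.F θ i j')
              (Set.finite_range _).bddAbove j'
          · exact le_rfl
      _ = G.U σ (f.report σ r) θ := by
          rw [Finset.sum_comm]
          simp [U]

/-- The leader's expected payoff if the follower is truthful and obedient. -/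
noncomputable def meanV (μ : PMF (Fin K)) (σ : Commitment M N K) : ℝ :=
  ∑ θ, (μ θ).toReal * G.V σ θ

theorem leaderValue_eq_meanV_direct (f : G.Follower) (μ : PMF (Fin K)) (σ : Commitment M N K) :
    G.leaderValue f μ σ = G.meanV μ (G.direct f σ) := by
  simp only [leaderValue, meanV, V, sum_sum_direct_C_mul]

/-- The revelation principle: a bound on the payoffs of feasible commitments bounds `opt`. -/
theorem opt_le [Nonempty (Commitment M N K)] (f : G.Follower) (μ : PMF (Fin K)) {X : ℝ}
    (hX : ∀ σ, G.IsIC σ → G.meanV μ σ ≤ X) : G.opt f μ ≤ X :=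
  -- An upper bound on the supremum needs nonemptiness only, since a real supremum over the empty
  -- type is `0`.
  ciSup_le fun σ => by
    rw [leaderValue_eq_meanV_direct]
    exact hX _ (G.direct_isIC f σ)

variable {G}

theorem abs_V_le {B : ℝ} (hL : ∀ i j, |G.L i j| ≤ B) (σ : Commitment M N K) (θ : Fin K) :
    |G.V σ θ| ≤ B := by
  calc |G.V σ θ| ≤ ∑ i, ∑ j, |σ.C θ i j * G.L i j| :=
        (Finset.abs_sum_le_sum_abs _ _).trans
          (Finset.sum_le_sum fun i _ => Finset.abs_sum_le_sum_abs _ _)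
    _ ≤ ∑ i, ∑ j, σ.C θ i j * B := by
        refine Finset.sum_le_sum fun i _ => Finset.sum_le_sum fun j _ => ?_
        rw [abs_mul, abs_of_nonneg (σ.nonneg θ i j)]
        exact mul_le_mul_of_nonneg_left (hL i j) (σ.nonneg θ i j)
    _ = B := by simp only [← Finset.sum_mul, σ.sum_C_eq_one, one_mul]

theorem abs_meanV_le {B : ℝ} (hL : ∀ i j, |G.L i j| ≤ B) (μ : PMF (Fin K))
    (σ : Commitment M N K) : |G.meanV μ σ| ≤ B := by
  calc |G.meanV μ σ| ≤ ∑ θ, |(μ θ).toReal * G.V σ θ| := Finset.abs_sum_le_sum_abs _ _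
    _ ≤ ∑ θ, (μ θ).toReal * B := by
        refine Finset.sum_le_sum fun θ _ => ?_
        rw [abs_mul, abs_of_nonneg ENNReal.toReal_nonneg]
        exact mul_le_mul_of_nonneg_left (abs_V_le hL σ θ) ENNReal.toReal_nonneg
    _ = B := by rw [← Finset.sum_mul, sum_toReal_eq_one, one_mul]

/-- The round in which a truthful and obedient follower of type `q.1` meets action `q.2.1` and
signal `q.2.2`. -/
def honestRound (q : Fin K × Fin M × Fin N) : Round M N K := ⟨q.1, q.1, q.2.1, q.2.2, q.2.2⟩

/-- The probability of `honestRound q`. -/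
noncomputable def roundWeight (μ : PMF (Fin K)) (σ : Commitment M N K)
    (q : Fin K × Fin M × Fin N) : ℝ := (μ q.1).toReal * σ.C q.1 q.2.1 q.2.2

theorem roundWeight_nonneg (μ : PMF (Fin K)) (σ : Commitment M N K)
    (q : Fin K × Fin M × Fin N) : 0 ≤ roundWeight μ σ q :=
  mul_nonneg ENNReal.toReal_nonneg (σ.nonneg _ _ _)

theorem sum_roundWeight_mul_type (μ : PMF (Fin K)) (σ : Commitment M N K) (g : Fin K → ℝ) :
    ∑ q, roundWeight μ σ q * g q.1 = ∑ θ, (μ θ).toReal * g θ := by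
  rw [Fintype.sum_prod_type]
  refine Finset.sum_congr rfl fun θ _ => ?_
  rw [Fintype.sum_prod_type]
  simp only [roundWeight, ← Finset.sum_mul, ← Finset.mul_sum, σ.sum_C_eq_one, mul_one]

theorem sum_roundWeight (μ : PMF (Fin K)) (σ : Commitment M N K) :
    ∑ q, roundWeight μ σ q = 1 := by
  simpa [sum_toReal_eq_one] using sum_roundWeight_mul_type μ σ fun _ => 1

theorem sum_roundWeight_mul_L (μ : PMF (Fin K)) (σ : Commitment M N K) :
    ∑ q, roundWeight μ σ q * G.L q.2.1 q.2.2 = G.meanV μ σ := by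
  rw [Fintype.sum_prod_type]
  refine Finset.sum_congr rfl fun θ _ => ?_
  rw [Fintype.sum_prod_type]
  simp only [roundWeight, mul_assoc, ← Finset.mul_sum, V]

/-- Feasibility leaves only honest rounds in the support, so the follower drops out and the
expectation is a finite sum. -/
theorem IsIC.expect_roundLaw {σ : Commitment M N K} (hσ : G.IsIC σ) (f : G.Follower)
    (μ : PMF (Fin K)) {g : Round M N K → ℝ} (hg : ∀ r, 0 ≤ g r) :
    expect (G.roundLaw f μ σ) (fun r => ENNReal.ofReal (g r)) =
      ENNReal.ofReal (∑ q, roundWeight μ σ q * g (honestRound q)) := by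
  rw [roundLaw, expect_bind]
  simp only [expect_map, hσ.report_eq, hσ.response_eq]
  simp only [expect, tsum_fintype]
  rw [Fintype.sum_prod_type, ENNReal.ofReal_sum_of_nonneg fun θ _ =>
    Finset.sum_nonneg fun p _ => mul_nonneg (roundWeight_nonneg μ σ _) (hg _)]
  refine Finset.sum_congr rfl fun θ _ => ?_
  rw [ENNReal.ofReal_sum_of_nonneg fun p _ =>
    mul_nonneg (roundWeight_nonneg μ σ _) (hg _), Finset.mul_sum]
  refine Finset.sum_congr rfl fun p _ => ?_
  rw [roundWeight, mul_assoc, ENNReal.ofReal_mul ENNReal.toReal_nonneg,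
    ENNReal.ofReal_toReal (μ.apply_ne_top θ), ENNReal.ofReal_mul (σ.nonneg _ _ _)]
  simp only [Commitment.joint, PMF.ofFintype_apply, honestRound]

end Game

/-! ### Processes along the play and their exponential moments. -/

section History

variable {M N K : ℕ}

/-- The sum over the rounds of a history of an increment that depends on the round and on the
history that precedes it. -/
def process (D : List (Round M N K) → Round M N K → ℝ) : List (Round M N K) → ℝ
  | [] => 0
  | r :: h => D h r + process D h

variable {G : Game M N K}

theorem expect_historyLaw_succ (f : G.Follower) (μ : PMF (Fin K)) (π : Policy M N K) (t : ℕ)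
    (g : List (Round M N K) → ℝ≥0∞) :
    expect (G.historyLaw f μ π (t + 1)) g = expect (G.historyLaw f μ π t) fun h =>
      expect (G.roundLaw f μ (π h)) fun r => g (r :: h) := by
  simp only [Game.historyLaw, expect_bind, expect_map]

theorem length_of_mem_support_historyLaw (f : G.Follower) (μ : PMF (Fin K)) (π : Policy M N K)
    (t : ℕ) : ∀ h ∈ (G.historyLaw f μ π t).support, h.length = t := by
  induction t with
  | zero =>
    intro h hh
    simp only [Game.historyLaw, PMF.support_pure, Set.mem_singleton_iff] at hh
    simp [hh]
  | succ t ih =>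
    intro h hh
    rw [Game.historyLaw, PMF.mem_support_bind_iff] at hh
    obtain ⟨h', hh', hm⟩ := hh
    rw [PMF.mem_support_map_iff] at hm
    obtain ⟨r, -, rfl⟩ := hm
    simp [ih h' hh']

/-- Exponential moment bound for processes with bounded centred increments. -/
theorem expect_exp_process_le {f : G.Follower} {μ : PMF (Fin K)} {π : Policy M N K}
    (hπ : ∀ h, G.IsIC (π h)) {D : List (Round M N K) → Round M N K → ℝ} {b : ℝ} (hb : 0 < b)
    (hD : ∀ h q, |D h (Game.honestRound q)| ≤ b)
    (h0 : ∀ h, ∑ q, Game.roundWeight μ (π h) q * D h (Game.honestRound q) = 0)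
    {l : ℝ} (hl : 0 < l) (t : ℕ) :
    expect (G.historyLaw f μ π t) (fun h => ENNReal.ofReal (Real.exp (l * process D h))) ≤
      ENNReal.ofReal (Real.exp (t * ((l * b) ^ 2 / 2))) := by
  induction t with
  | zero => simp [Game.historyLaw, expect_pure, process]
  | succ t ih =>
    rw [expect_historyLaw_succ]
    calc _ ≤ expect (G.historyLaw f μ π t) fun h =>
          ENNReal.ofReal (Real.exp ((l * b) ^ 2 / 2)) *
            ENNReal.ofReal (Real.exp (l * process D h)) := by
          -- Given the past `h`, the factor of `process D h` is fixed, and Hoeffding's lemma bounds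
          -- that of the new increment.
          refine expect_mono _ fun h => ?_
          rw [(hπ h).expect_roundLaw f μ fun r => (Real.exp_pos _).le,
            ← ENNReal.ofReal_mul (Real.exp_pos _).le]
          refine ENNReal.ofReal_le_ofReal ?_
          simp only [process, mul_add, Real.exp_add, ← mul_assoc, ← Finset.sum_mul]
          refine mul_le_mul_of_nonneg_right ?_ (Real.exp_pos _).le
          refine sum_mul_exp_le _ (fun q => l * D h (Game.honestRound q)) (mul_pos hl hb)
            (Game.roundWeight_nonneg μ (π h)) (Game.sum_roundWeight μ (π h)) (fun q => ?_) ?_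
          · rw [abs_mul, abs_of_pos hl]
            exact mul_le_mul_of_nonneg_left (hD h q) hl.le
          · simp only [mul_left_comm _ l, ← Finset.mul_sum, h0, mul_zero]
      _ ≤ _ := by
          rw [expect_const_mul]
          refine (mul_le_mul_right ih _).trans ?_
          rw [← ENNReal.ofReal_mul (Real.exp_pos _).le, ← Real.exp_add]
          refine ENNReal.ofReal_le_ofReal (Real.exp_le_exp.2 ?_)
          push_cast
          linarith

/-- Chernoff bound for processes with bounded centred increments. -/
theorem expect_exp_process_sub_le {f : G.Follower} {μ : PMF (Fin K)} {π : Policy M N K}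
    (hπ : ∀ h, G.IsIC (π h)) {D : List (Round M N K) → Round M N K → ℝ} {b : ℝ} (hb : 0 < b)
    (hD : ∀ h q, |D h (Game.honestRound q)| ≤ b)
    (h0 : ∀ h, ∑ q, Game.roundWeight μ (π h) q * D h (Game.honestRound q) = 0)
    {s : ℝ} (hs : 0 < s) {t : ℕ} (ht : 0 < t) :
    expect (G.historyLaw f μ π t)
      (fun h => ENNReal.ofReal (Real.exp (s / (b ^ 2 * t) * (process D h - s)))) ≤
      ENNReal.ofReal (Real.exp (-(s ^ 2 / (2 * b ^ 2 * t)))) := by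
  have ht' : (0 : ℝ) < t := by exact_mod_cast ht
  -- This slope minimizes `t (l b)² / 2 - l s` over `l`.
  have hl : 0 < s / (b ^ 2 * t) := by positivity
  have h := expect_exp_process_le (f := f) hπ hb hD h0 hl t
  have e : ∀ h : List (Round M N K),
      ENNReal.ofReal (Real.exp (s / (b ^ 2 * t) * (process D h - s))) =
        ENNReal.ofReal (Real.exp (-(s / (b ^ 2 * t) * s))) *
          ENNReal.ofReal (Real.exp (s / (b ^ 2 * t) * process D h)) := fun h => by
    rw [← ENNReal.ofReal_mul (Real.exp_pos _).le, ← Real.exp_add]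
    ring_nf
  simp only [e]
  rw [expect_const_mul]
  refine (mul_le_mul_right h _).trans ?_
  rw [← ENNReal.ofReal_mul (Real.exp_pos _).le, ← Real.exp_add]
  refine ENNReal.ofReal_le_ofReal (Real.exp_le_exp.2 (le_of_eq ?_))
  field_simp
  ring

/-- The sum of `w` over all nonempty prefixes of the play recorded in a history. -/
def prefixSum (w : List (Round M N K) → ℝ≥0∞) : List (Round M N K) → ℝ≥0∞
  | [] => 0
  | r :: h => w (r :: h) + prefixSum w h

/-- The first `t` rounds of a longer play have law `historyLaw t`, so the expectation splits over
times. -/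
theorem expect_prefixSum (f : G.Follower) (μ : PMF (Fin K)) (π : Policy M N K)
    (w : List (Round M N K) → ℝ≥0∞) (T : ℕ) :
    expect (G.historyLaw f μ π T) (prefixSum w) =
      ∑ t ∈ Finset.range T, expect (G.historyLaw f μ π (t + 1)) w := by
  induction T with
  | zero => simp [Game.historyLaw, expect_pure, prefixSum]
  | succ T ih =>
    rw [Finset.sum_range_succ, ← ih, expect_historyLaw_succ, expect_historyLaw_succ,
      ← expect_add]
    simp only [prefixSum, expect_add, expect_const]
    simp only [← expect_add, add_comm]

/-- Histories list the latest round first, so a list suffix is an initial segment of the play.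
Dominating each weight by the sum is the union bound over times. -/
theorem le_prefixSum (w : List (Round M N K) → ℝ≥0∞) {s h : List (Round M N K)}
    (hs : s <:+ h) (hne : s ≠ []) : w s ≤ prefixSum w h := by
  induction h with
  | nil => exact absurd (List.suffix_nil.1 hs) hne
  | cons r h ih =>
    rcases List.suffix_cons_iff.1 hs with rfl | hs'
    · exact le_self_add
    · exact (ih hs').trans le_add_self

/-! ### Frequency deviations, payoff deviations and the gap on good histories. -/

/-- Centred indicator of type `θ`. -/
noncomputable def typeDev (μ : PMF (Fin K)) (θ : Fin K) (_ : List (Round M N K))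
    (r : Round M N K) : ℝ := (if r.type = θ then 1 else 0) - (μ θ).toReal

theorem abs_typeDev_le (μ : PMF (Fin K)) (θ : Fin K) (h : List (Round M N K))
    (r : Round M N K) : |typeDev μ θ h r| ≤ 1 := by
  have h0 : 0 ≤ (μ θ).toReal := ENNReal.toReal_nonneg
  have h1 : (μ θ).toReal ≤ 1 :=
    ENNReal.toReal_le_of_le_ofReal zero_le_one (by simpa using μ.coe_le_one θ)
  unfold typeDev
  rw [abs_le]
  split_ifs <;> constructor <;> linarith

theorem sum_roundWeight_mul_typeDev (μ : PMF (Fin K)) (σ : Commitment M N K) (θ : Fin K)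
    (h : List (Round M N K)) :
    ∑ q, Game.roundWeight μ σ q * typeDev μ θ h (Game.honestRound q) = 0 := by
  have e := Game.sum_roundWeight_mul_type μ σ
    fun θ' => (if θ' = θ then 1 else 0) - (μ θ).toReal
  refine e.trans ?_
  simp [mul_sub, ← Finset.sum_mul, sum_toReal_eq_one]

theorem process_neg (D : List (Round M N K) → Round M N K → ℝ) (h : List (Round M N K)) :
    process (fun h r => -D h r) h = -process D h := by
  induction h with
  | nil => simp [process]
  | cons r h ih =>
    simp only [process, ih]
    ring

/-- The sampling error of every commitment is a linear form in the same `K` frequency deviations,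
which makes it uniform in `σ`. -/
theorem sum_V_type (μ : PMF (Fin K)) (σ : Commitment M N K) (h : List (Round M N K)) :
    (h.map fun r => G.V σ r.type).sum =
      h.length * G.meanV μ σ + ∑ θ, G.V σ θ * process (typeDev μ θ) h := by
  induction h with
  | nil => simp [process]
  | cons r h ih =>
    have e : G.V σ r.type = G.meanV μ σ + ∑ θ, G.V σ θ * typeDev μ θ h r := by
      simp [typeDev, mul_sub, Game.meanV, mul_comm]
    simp only [List.map_cons, List.sum_cons, ih, process, mul_add, Finset.sum_add_distrib, e,
      List.length_cons]
    push_cast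
    ring

/-- The expected loss of the next commitment is controlled by the deviations of the empirical
type frequencies. -/
theorem length_mul_opt_sub_meanV_le {B : ℝ} (hL : ∀ i j, |G.L i j| ≤ B) (f : G.Follower)
    {π : Policy M N K} (hπ : G.IsFTLIC π) (μ : PMF (Fin K)) {h : List (Round M N K)}
    (hne : h ≠ []) :
    h.length * (G.opt f μ - G.meanV μ (π h)) ≤ 2 * B * ∑ θ, |process (typeDev μ θ) h| := by
  have : Nonempty (Commitment M N K) := ⟨π h⟩
  have hpos : (0 : ℝ) < h.length := by exact_mod_cast List.length_pos_iff.2 hne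
  have key : ∀ σ : Commitment M N K,
      |∑ θ, G.V σ θ * process (typeDev μ θ) h| ≤ B * ∑ θ, |process (typeDev μ θ) h| := by
    intro σ
    rw [Finset.mul_sum]
    refine (Finset.abs_sum_le_sum_abs _ _).trans (Finset.sum_le_sum fun θ _ => ?_)
    rw [abs_mul]
    exact mul_le_mul_of_nonneg_right (Game.abs_V_le hL σ θ) (abs_nonneg _)
  have hopt : G.opt f μ ≤
      G.meanV μ (π h) + 2 * B * (∑ θ, |process (typeDev μ θ) h|) / h.length := by
    refine G.opt_le f μ fun σ hσ => ?_
    -- `π h` wins empirically. Passing to true means costs one error for `σ` and one for `π h`,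
    -- whence the factor `2`.
    have h1 := (hπ h).2 σ hσ
    rw [sum_V_type μ, sum_V_type μ] at h1
    have h2 := abs_le.1 (key σ)
    have h3 := abs_le.1 (key (π h))
    rw [← sub_le_iff_le_add', le_div_iff₀ hpos]
    linarith
  rw [← sub_le_iff_le_add', le_div_iff₀ hpos] at hopt
  linarith

/-- Difference between the expected and the realized payoff of a round. -/
noncomputable def payoffDev (G : Game M N K) (μ : PMF (Fin K)) (π : Policy M N K)
    (h : List (Round M N K)) (r : Round M N K) : ℝ :=
  G.meanV μ (π h) - G.L r.action r.response

theorem abs_payoffDev_le {B : ℝ} (hL : ∀ i j, |G.L i j| ≤ B) (μ : PMF (Fin K))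
    (π : Policy M N K) (h : List (Round M N K)) (r : Round M N K) :
    |payoffDev G μ π h r| ≤ 2 * B :=
  (abs_sub _ _).trans
    (by linarith [Game.abs_meanV_le hL μ (π h), hL r.action r.response])

theorem sum_roundWeight_mul_payoffDev (μ : PMF (Fin K)) (π : Policy M N K)
    (h : List (Round M N K)) :
    ∑ q, Game.roundWeight μ (π h) q * payoffDev G μ π h (Game.honestRound q) = 0 := by
  simp only [payoffDev, Game.honestRound, mul_sub, Finset.sum_sub_distrib,
    Game.sum_roundWeight_mul_L, ← Finset.sum_mul, Game.sum_roundWeight, one_mul, sub_self]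

/-- The difference of roots is `1 / (√(t + 1) + √t)`, and `√(t + 1) ≤ 2√t`. It lets the sum of the
`1 / √t` telescope by induction. -/
theorem one_div_sqrt_le {t : ℝ} (ht : 1 ≤ t) : 1 / √t ≤ 3 * (√(t + 1) - √t) := by
  have h0 : 0 < √t := Real.sqrt_pos.2 (by linarith)
  have h1 : √t ^ 2 = t := Real.sq_sqrt (by linarith)
  have h2 : √(t + 1) ^ 2 = t + 1 := Real.sq_sqrt (by linarith)
  have h3 : √(t + 1) ≤ 2 * √t := by
    refine Real.sqrt_le_iff.2 ⟨by positivity, by nlinarith⟩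
  have h4 : √t ≤ √(t + 1) := Real.sqrt_le_sqrt (by linarith)
  rw [div_le_iff₀ h0]
  nlinarith

/-- The gap on histories all of whose prefixes have nearly correct type frequencies. -/
theorem gap_cons_le {B : ℝ} (hB : 0 ≤ B) (hL : ∀ i j, |G.L i j| ≤ B) (f : G.Follower)
    {π : Policy M N K} (hπ : G.IsFTLIC π) (μ : PMF (Fin K)) {A : ℝ} (h : List (Round M N K))
    (hA : ∀ s, s <:+ h → s ≠ [] → ∀ θ, |process (typeDev μ θ) s| ≤ √(A * s.length))
    (r : Round M N K) :
    G.gap f μ (h.length + 1) (r :: h) ≤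
      process (payoffDev G μ π) (r :: h) + 2 * B + 6 * B * K * √A * √((h.length : ℝ) + 1) := by
  induction h generalizing r with
  | nil =>
    -- The opening commitment rests on no data; its loss is at most `2 * B`.
    have : Nonempty (Commitment M N K) := ⟨π []⟩
    have h1 : G.opt f μ ≤ B :=
      G.opt_le f μ fun σ _ => (abs_le.1 (Game.abs_meanV_le hL μ σ)).2
    have h2 := (abs_le.1 (Game.abs_meanV_le hL μ (π []))).1
    have h3 : 0 ≤ 6 * B * K * √A := by positivity
    simp [Game.gap, process, payoffDev]
    linarith
  | cons r' h ih =>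
    have ih' := ih (fun s hs => hA s (hs.trans (List.suffix_cons _ _))) r'
    have h1 := length_mul_opt_sub_meanV_le hL f hπ μ (List.cons_ne_nil r' h)
    have h2 := hA _ List.suffix_rfl (List.cons_ne_nil r' h)
    have e : ((r' :: h).length : ℝ) = h.length + 1 := by push_cast [List.length_cons]; rfl
    rw [e] at h1 h2
    set t : ℝ := (h.length : ℝ) + 1 with ht
    have ht1 : 1 ≤ t := by simp [ht]
    have ht0 : 0 < t := by linarith
    have hst : 0 < √t := Real.sqrt_pos.2 ht0
    have h3 : ∑ θ, |process (typeDev μ θ) (r' :: h)| ≤ K * (√A * √t) := by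
      refine (Finset.sum_le_sum fun θ _ => h2 θ).trans (le_of_eq ?_)
      rw [Finset.sum_const, Finset.card_univ, Fintype.card_fin, nsmul_eq_mul,
        Real.sqrt_mul' _ ht0.le]
    have h4 : G.opt f μ - G.meanV μ (π (r' :: h)) ≤ 2 * B * K * √A * (1 / √t) := by
      have h5 : t * (G.opt f μ - G.meanV μ (π (r' :: h))) ≤ t * (2 * B * K * √A * (1 / √t)) := by
        refine h1.trans ((mul_le_mul_of_nonneg_left h3 (by positivity)).trans (le_of_eq ?_))
        have h6 : √t * √t = t := Real.mul_self_sqrt ht0.le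
        field_simp
        rw [sq, h6]
      exact le_of_mul_le_mul_left h5 ht0
    have h5 := mul_le_mul_of_nonneg_left (one_div_sqrt_le ht1)
      (show 0 ≤ 2 * B * K * √A by positivity)
    simp only [Game.gap, process, payoffDev, List.map_cons, List.sum_cons, List.length_cons,
      Nat.cast_add, Nat.cast_one] at ih' ⊢
    rw [← ht] at ih' ⊢
    linarith

end History

/-! ### Union bounds and confidence levels. -/

/-- The union runs over times, types and both signs. At level `√(A t)` each term costs `exp (-A /
2)`, whatever `t` is. -/
theorem expect_typeDev_le {M N K : ℕ} {G : Game M N K} (f : G.Follower) {π : Policy M N K}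
    (hπ : ∀ h, G.IsIC (π h)) (μ : PMF (Fin K)) {A : ℝ} (hA : 0 < A) (T : ℕ) :
    expect (G.historyLaw f μ π T) (prefixSum fun s => ∑ θ, (
      ENNReal.ofReal (Real.exp (√(A * s.length) / (1 ^ 2 * s.length) *
        (process (typeDev μ θ) s - √(A * s.length)))) +
      ENNReal.ofReal (Real.exp (√(A * s.length) / (1 ^ 2 * s.length) *
        (process (fun h r => -typeDev μ θ h r) s - √(A * s.length)))))) ≤
      ENNReal.ofReal (T * (2 * K * Real.exp (-(A / 2)))) := by
  have step : ∀ t : ℕ, ∀ D : List (Round M N K) → Round M N K → ℝ,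
      (∀ h q, |D h (Game.honestRound q)| ≤ 1) →
      (∀ h, ∑ q, Game.roundWeight μ (π h) q * D h (Game.honestRound q) = 0) →
      expect (G.historyLaw f μ π (t + 1)) (fun s =>
        ENNReal.ofReal (Real.exp (√(A * s.length) / (1 ^ 2 * s.length) *
          (process D s - √(A * s.length))))) ≤ ENNReal.ofReal (Real.exp (-(A / 2))) := by
    intro t D hD h0
    have ht : (0 : ℝ) < ((t + 1 : ℕ) : ℝ) := by positivity
    have h := expect_exp_process_sub_le (f := f) hπ one_pos hD h0
      (s := √(A * (t + 1 : ℕ))) (by positivity) (Nat.succ_pos t)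
    refine (le_of_eq ?_).trans (h.trans (le_of_eq ?_))
    · refine tsum_congr fun s => ?_
      -- The length is known only on the support; elsewhere the probability vanishes.
      by_cases hs : s ∈ (G.historyLaw f μ π (t + 1)).support
      · simp only [length_of_mem_support_historyLaw f μ π _ s hs, Nat.succ_eq_add_one]
      · rw [PMF.mem_support_iff, not_not] at hs
        simp [hs]
    · rw [Real.sq_sqrt (by positivity)]
      congr 3
      field_simp
  rw [expect_prefixSum]
  calc _ ≤ ∑ t ∈ Finset.range T, ∑ θ : Fin K,
        (ENNReal.ofReal (Real.exp (-(A / 2))) + ENNReal.ofReal (Real.exp (-(A / 2)))) := by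
        refine Finset.sum_le_sum fun t _ => ?_
        rw [expect_sum]
        refine Finset.sum_le_sum fun θ _ => ?_
        rw [expect_add]
        refine add_le_add (step t _ (fun h q => abs_typeDev_le μ θ h _)
          fun h => sum_roundWeight_mul_typeDev μ (π h) θ h)
          (step t (fun h r => -typeDev μ θ h r) (fun h q => ?_) fun h => ?_)
        · rw [abs_neg]
          exact abs_typeDev_le μ θ h _
        · simp only [mul_neg, Finset.sum_neg_distrib, sum_roundWeight_mul_typeDev, neg_zero]
    _ = _ := by
        simp only [Finset.sum_const, Finset.card_univ, Fintype.card_fin, Finset.card_range,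
          nsmul_eq_mul]
        rw [← ENNReal.ofReal_add (Real.exp_pos _).le (Real.exp_pos _).le,
          ← ENNReal.ofReal_natCast K, ← ENNReal.ofReal_natCast T,
          ← ENNReal.ofReal_mul (by positivity), ← ENNReal.ofReal_mul (by positivity)]
        ring_nf

/-- High-probability bound on the gap with the confidence levels left as parameters. -/
theorem gap_le_with_prob {M N K : ℕ} {G : Game M N K} {B : ℝ} (hB : 0 < B)
    (hL : ∀ i j, |G.L i j| ≤ B) (f : G.Follower) {π : Policy M N K} (hπ : G.IsFTLIC π)
    (μ : PMF (Fin K)) {A s : ℝ} (hA : 0 < A) (hs : 0 < s) {T : ℕ} (hT : 1 ≤ T) :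
    1 - (T * (2 * K * Real.exp (-(A / 2))) + Real.exp (-(s ^ 2 / (2 * (2 * B) ^ 2 * T)))) ≤
      ((G.historyLaw f μ π T).toOuterMeasure
        {h | G.gap f μ T h ≤ s + 2 * B + 6 * B * K * √A * √T}).toReal := by
  have hIC : ∀ h, G.IsIC (π h) := fun h => (hπ h).1
  have h1 := expect_typeDev_le f hIC μ hA T
  have h2 := expect_exp_process_sub_le (f := f) (μ := μ) hIC (D := payoffDev G μ π)
    (b := 2 * B) (by positivity) (fun h q => abs_payoffDev_le hL μ π h _)
    (fun h => sum_roundWeight_mul_payoffDev μ π h) hs hT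
  have h3 := add_le_add h1 h2
  rw [← expect_add, ← ENNReal.ofReal_add (by positivity) (by positivity)] at h3
  refine one_sub_le_toOuterMeasure _ _ _ _ (by positivity) (fun h hh hbad => ?_) h3
  have hlen := length_of_mem_support_historyLaw f μ π T h hh
  -- On a bad history either the frequencies are good and the payoff martingale exceeds `s`, or some
  -- frequency deviates; the matching exponential weight is at least `1`.
  by_cases hg : ∀ s', s' <:+ h → s' ≠ [] → ∀ θ, |process (typeDev μ θ) s'| ≤ √(A * s'.length)
  · refine le_trans ?_ le_add_self
    rw [ENNReal.one_le_ofReal, Real.one_le_exp_iff]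
    refine mul_nonneg (by positivity) ?_
    cases h with
    | nil => simp at hlen; omega
    | cons r h =>
      have h4 := gap_cons_le hB.le hL f hπ μ h
        (fun s' hs' => hg s' (hs'.trans (List.suffix_cons _ _))) r
      rw [List.length_cons] at hlen
      have e : (h.length : ℝ) + 1 = T := by exact_mod_cast hlen
      rw [hlen, e] at h4
      simp only [Set.mem_ofPred_eq, not_le] at hbad
      linarith
  · push Not at hg
    obtain ⟨s', hs', hne, θ, hlt⟩ := hg
    refine le_trans ?_ le_self_add
    refine le_trans ?_ (le_prefixSum _ hs' hne)
    refine le_trans ?_ (Finset.single_le_sum (fun _ _ => zero_le) (Finset.mem_univ θ))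
    rcases lt_abs.1 hlt with h5 | h5
    · refine le_trans ?_ le_self_add
      rw [ENNReal.one_le_ofReal, Real.one_le_exp_iff]
      exact mul_nonneg (by positivity) (by linarith)
    · refine le_trans ?_ le_add_self
      rw [ENNReal.one_le_ofReal, Real.one_le_exp_iff, process_neg]
      exact mul_nonneg (by positivity) (by linarith)

/-- A logarithmic confidence level proportional to `K` absorbs the union bound over the types. -/
theorem union_bound_le {K M T : ℕ} (hM : 1 ≤ M) (hT : 2 ≤ T) :
    (T : ℝ) * (2 * K * Real.exp (-(2 * (1 + 2 * K) * M * Real.log T / 2))) ≤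
      (T : ℝ) ^ (1 - 3 * √(M : ℝ) / 56) := by
  have hT' : (2 : ℝ) ≤ T := by exact_mod_cast hT
  have hT0 : (0 : ℝ) < T := by linarith
  have hM' : (1 : ℝ) ≤ M := by exact_mod_cast hM
  have hsq : √(M : ℝ) ≤ M := by
    rw [Real.sqrt_le_left (by linarith)]
    nlinarith
  have hK : (2 * K : ℝ) ≤ (T : ℝ) ^ (2 * K : ℝ) := by
    have h1 : (2 * K : ℕ) ≤ T ^ (2 * K) := (Nat.lt_pow_self (by omega)).le
    have h2 : ((2 * K : ℕ) : ℝ) ≤ (T : ℝ) ^ (2 * K) := by exact_mod_cast h1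
    rw [← Real.rpow_natCast] at h2
    push_cast at h2
    exact h2
  have e : Real.exp (-(2 * (1 + 2 * K) * M * Real.log T / 2)) =
      (T : ℝ) ^ (-((1 + 2 * K) * M : ℝ)) := by
    rw [Real.rpow_def_of_pos hT0]
    congr 1
    ring
  rw [e]
  calc (T : ℝ) * (2 * K * (T : ℝ) ^ (-((1 + 2 * K) * M : ℝ)))
      ≤ (T : ℝ) * ((T : ℝ) ^ (2 * K : ℝ) * (T : ℝ) ^ (-((1 + 2 * K) * M : ℝ))) := by gcongr
    _ = (T : ℝ) ^ (1 + (2 * K + -((1 + 2 * K) * M)) : ℝ) := by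
        rw [Real.rpow_add hT0, Real.rpow_add hT0, Real.rpow_one]
    _ ≤ _ := by
        -- The left exponent is `1 - M - 2K(M - 1)`, at most `1 - M`, and `M` exceeds `3√M / 56`.
        refine Real.rpow_le_rpow_of_exponent_le (by linarith) ?_
        have : (0 : ℝ) ≤ K := Nat.cast_nonneg K
        nlinarith

end SigBSG

theorem mainTheorem7 (K : ℕ) (B : ℝ) :
    ∃ c : ℝ, ∀ (M N : ℕ) (G : SigBSG.Game M N K), (∀ i j, |G.L i j| ≤ B) →
      ∀ (f : G.Follower) (π : SigBSG.Policy M N K), G.IsFTLIC π →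
      ∀ (μ : PMF (Fin K)) (T : ℕ), 1 ≤ T →
        1 - (T : ℝ) ^ (1 - 3 * √(M : ℝ) / 56) - (T : ℝ) ^ (-(8 * (M : ℝ))) ≤
          ((G.historyLaw f μ π T).toOuterMeasure
            {h | G.gap f μ T h ≤
              c * (√((M : ℝ) * T) * (1 + 2 * √(Real.log T)))}).toReal := by
  -- `B` may fail to be positive, while the concentration bounds divide by it.
  set b : ℝ := max B 1
  have hb : 0 < b := lt_max_of_lt_right one_pos
  set a : ℝ := 2 * (1 + 2 * K)
  have ha : 0 < a := by positivity
  -- The summands pay for the payoff martingale, the opening round and the frequency errors.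
  refine ⟨8 * b + 2 * b + 6 * b * K * √a, fun M N G hL f π hπ μ T hT => ?_⟩
  have hL' : ∀ i j, |G.L i j| ≤ b := fun i j => (hL i j).trans (le_max_left _ _)
  -- For `T = 1` the claimed probability is `-1`.
  rcases hT.eq_or_lt with rfl | hT2
  · simp only [Nat.cast_one, Real.one_rpow, sub_self, zero_sub]
    exact le_trans (by norm_num) ENNReal.toReal_nonneg
  have hM : 1 ≤ M := by
    rcases Nat.eq_zero_or_pos M with rfl | hM
    · have := (π []).mem_simplex.2
      simp at this
    · exact hM
  have hM' : (1 : ℝ) ≤ M := by exact_mod_cast hM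
  have hT' : (2 : ℝ) ≤ T := by exact_mod_cast hT2
  have hT0 : (0 : ℝ) < T := by linarith
  have hlog : 0 < Real.log T := Real.log_pos (by linarith)
  set Q : ℝ := √((M : ℝ) * T) with hQ
  have hQ1 : 1 ≤ Q := Real.one_le_sqrt.2 (by nlinarith)
  -- With increments bounded by `2 * b`, this level gives the exponent `-8 M log T`.
  have hs : 0 < 8 * b * (Q * √(Real.log T)) := by positivity
  have main := SigBSG.gap_le_with_prob hb hL' f hπ μ
    (show 0 < a * M * Real.log T by positivity) hs hT
  have hu := SigBSG.union_bound_le (K := K) hM hT2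
  have he : Real.exp (-((8 * b * (Q * √(Real.log T))) ^ 2 / (2 * (2 * b) ^ 2 * T))) =
      (T : ℝ) ^ (-(8 * (M : ℝ))) := by
    rw [Real.rpow_def_of_pos hT0, mul_pow, mul_pow Q, hQ, Real.sq_sqrt (by positivity),
      Real.sq_sqrt hlog.le]
    congr 1
    field_simp
    ring
  rw [he] at main
  refine le_trans (by linarith) (main.trans (ENNReal.toReal_mono ?_ ?_))
  · refine ne_top_of_le_ne_top ENNReal.one_ne_top ?_
    rw [PMF.toOuterMeasure_apply, ← (G.historyLaw f μ π T).tsum_coe]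
    exact ENNReal.tsum_le_tsum fun h => Set.indicator_le_self _ _ _
  · refine MeasureTheory.measure_mono fun h hh => ?_
    refine (Set.mem_ofPred_eq ▸ hh : G.gap f μ T h ≤ _).trans ?_
    have e : √(a * M * Real.log T) * √(T : ℝ) = √a * (Q * √(Real.log T)) := by
      rw [hQ, ← Real.sqrt_mul (by positivity), ← Real.sqrt_mul (by positivity),
        ← Real.sqrt_mul ha.le]
      congr 1
      ring
    rw [mul_assoc _ √(a * M * Real.log T), e]
    have h1 : 0 ≤ Q * √(Real.log T) := by positivity
    have h2 : 0 ≤ 6 * b * K * √a := by positivity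
    nlinarith [mul_nonneg h2 h1, mul_nonneg hb.le h1, mul_le_mul_of_nonneg_left hQ1 hb.le,
      mul_le_mul_of_nonneg_left hQ1 h2]
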